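/- Let $n\ge 1$, let $q(x)=1$ for $|x|<1$ and $q(x)=2$ for $|x|\ge 1$ ($x\in\mathbb R^n$), so that $\underline q=\operatorname{ess\,inf} q=1$ and $\overline q=\operatorname{ess\,sup} q=2$. Let $0<p\le q(x)$ for all $x$ (that is, $0<p\le 1$) and $\beta\in\mathbb R$. For a measurable $\Omega\subseteq\mathbb R^n$, a weight $w$ and a measurable $g\ge 0$ put $$\|g\|_{L_{q(\cdot),w}(\Omega)}=\inf\Big\{\lambda>0:\ \int_\Omega\Big(\frac{g(x)w(x)}{\lambda}\Big)^{q(x)}dx\le 1\Big\},\qquad L_{q(\cdot)}=L_{q(\cdot),1},$$ and for measurable $f>0$ on $\mathbb R^n$ let $$Gf(x)=\exp\Big(\frac1{|B(0,|x|)|}\int_{B(0,|x|)}\ln f(y)\,dy\Big),$$ where $B(0,r)=\{y:|y|<r\}$ and $\exp(-\infty)=0$. Then the inequality $$\|Gf\|_{L_{q(\cdot),|\cdot|^\beta}(\mathbb R^n)}\le C\Big(\int_{\mathbb R^n}f^p(x)\,dx\Big)^{1/p}\quad\text{for all measurable } f>0$$ holds with a finite constant $C$ if and only if $$n\Big(\frac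 sp-1\Big)\le\beta\le n\Big(\frac1p-\frac12\Big)\quad\text{for some } s\in\Big[1,1+\frac p2\Big].$$ In this case the best (smallest) constant $C$ satisfies $$\sup_{1<s\le 1+\frac p2}\frac{e^{s/p}}{\big(e^s+\frac1{s-1}\big)^{1/p}}\,D'(s,p,q)\ \le\ C\ \le\ \Big(\frac p{\underline q}+\frac{\overline q-p}{\overline q}\Big)^{2/p}\inf_{1<s\le 1+\frac p2}e^{\frac{s-1}p}\,D'(s,p,q),$$ where, for every $s\in(1,1+\frac p2]$, $$D'(s,p,q)=|B(0,1)|^{-1/p}\,\sup_{t>0}\,t^{\frac{n(s-1)}p}\,\big\|\,|\cdot|^{\beta-\frac{ns}p}\,\big\|_{L_{q(\cdot)}(\{|x|>t\})}<\infty .$$ -/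

import Mathlib

open MeasureTheory
open scoped ENNReal NNReal

noncomputable section

/-- The quasi-norm of the weighted variable exponent Lebesgue space `L_{q(·), ω}(Ω)`, for
`Ω ⊆ ℝⁿ` and `f` with values in `[0, ∞]`: the infimum of the numbers `0 < l < ∞` such that
`∫_Ω (f(x) ω(x) / l)^{q(x)} dx ≤ 1` (it is `∞` if there is no such `l`). -/
def luxemburgNorm {n : ℕ} (Ω : Set (EuclideanSpace ℝ (Fin n)))
    (q ω : EuclideanSpace ℝ (Fin n) → ℝ) (f : EuclideanSpace ℝ (Fin n) → ℝ≥0∞) : ℝ≥0∞ :=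
  sInf {l : ℝ≥0∞ | 0 < l ∧ l < ∞ ∧ ∫⁻ x in Ω, (f x * ENNReal.ofReal (ω x) / l) ^ q x ≤ 1}

/-- The extended-real integral `∫_S ln f(y) dy`, as the integral of the positive part minus that of
the negative part. It is the usual integral if `ln f` is integrable on `S`; it is `-∞` if only the
positive part is integrable. -/
def logIntegral {n : ℕ} (f : EuclideanSpace ℝ (Fin n) → ℝ)
    (S : Set (EuclideanSpace ℝ (Fin n))) : EReal :=
  ((∫⁻ y in S, ENNReal.ofReal (Real.log (f y)) : ℝ≥0∞) : EReal) -
    ((∫⁻ y in S, ENNReal.ofReal (-Real.log (f y)) : ℝ≥0∞) : EReal)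

/-- The geometric mean operator
`G f (x) = exp (|B(0,|x|)|⁻¹ ∫_{B(0,|x|)} ln f(y) dy)`, where `exp (-∞) = 0`. -/
def geomMeanOp {n : ℕ} (f : EuclideanSpace ℝ (Fin n) → ℝ) (x : EuclideanSpace ℝ (Fin n)) : ℝ≥0∞ :=
  EReal.exp (logIntegral f (Metric.ball 0 ‖x‖) /
    ((volume (Metric.ball (0 : EuclideanSpace ℝ (Fin n)) ‖x‖) : ℝ≥0∞) : EReal))

/-- The exponent `q(x) = 1` for `|x| < 1` and `q(x) = 2` for `|x| ≥ 1`. -/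
def stepExponent (n : ℕ) (x : EuclideanSpace ℝ (Fin n)) : ℝ :=
  if ‖x‖ < 1 then 1 else 2

/-- The inequality `‖G f‖_{L_{q(·), |·|^β}(ℝⁿ)} ≤ C (∫ f^p)^{1/p}` for all positive measurable
functions `f` on `ℝⁿ`. -/
def GeomMeanInequality {n : ℕ} (q : EuclideanSpace ℝ (Fin n) → ℝ) (p β : ℝ) (C : ℝ≥0) : Prop :=
  ∀ f : EuclideanSpace ℝ (Fin n) → ℝ, AEMeasurable f volume → (∀ x, 0 < f x) →
    luxemburgNorm Set.univ q (fun x => ‖x‖ ^ β) (geomMeanOp f) ≤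
      C * (∫⁻ x, ENNReal.ofReal (f x) ^ p) ^ (1 / p)

/-- The best constant in the inequality: the infimum of all admissible finite constants
(`∞` if there is none). -/
def bestGeomMeanConstant {n : ℕ} (q : EuclideanSpace ℝ (Fin n) → ℝ) (p β : ℝ) : ℝ≥0∞ :=
  ⨅ (C : ℝ≥0) (_ : GeomMeanInequality q p β C), (C : ℝ≥0∞)

/-- `D'(s,p,q) = |B(0,1)|^{-1/p} sup_{t>0} t^{n(s-1)/p} ‖ |·|^{β - ns/p} ‖_{L_{q(·)}(|·| > t)}`. -/
def dPrime {n : ℕ} (q : EuclideanSpace ℝ (Fin n) → ℝ) (β s p : ℝ) : ℝ≥0∞ :=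
  volume (Metric.ball (0 : EuclideanSpace ℝ (Fin n)) 1) ^ (-1 / p) *
    ⨆ (t : ℝ) (_ : 0 < t), ENNReal.ofReal (t ^ (n * (s - 1) / p)) *
      luxemburgNorm {x | t < ‖x‖} q (fun _ => 1)
        (fun x => ENNReal.ofReal (‖x‖ ^ (β - n * s / p)))

end

/-!
Upper bound: `|y|^κ` has geometric mean `e^{-κ/n} |x|^κ` over `B(0,|x|)`, so Jensen's inequality for
`f^p |y|^κ` with `κ = n(s-1)` bounds `(Gf)^p` by an integral of `f^p` against a kernel supported on
`{|y| < |x|}`. After division by `∫ f^p` the density `f^p` is a probability measure; Jensen's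
inequality for the exponent `q(x)/p ≥ 1` and Tonelli's theorem then leave the integral of the kernel
in `x`, which is at most `1` for every `y` precisely because `t = |y|` is admissible in the
supremum defining `D'(s,p,q)`.

Lower bound: a truncated power whose logarithm exceeds its value on `{|y| ≤ t}` by a function with
an explicit average turns `‖Gf‖` into the norm of `t^{n(s-1)/p} |x|^{β - ns/p}` on `{|x| > t}`.

For the step exponent, `D'(s,p,q)` is finite exactly in the stated range of `β`: on `{|x| < 1}` and
on `{|x| ≥ 1}` the power is dominated by the scale invariant one for `q = 1` and `q = 2`, and
conversely small and large dyadic annuli force the two bounds.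
-/

open Metric Module

section EssSup
variable {α β : Type*} {m : MeasurableSpace α} {μ : Measure α} [ConditionallyCompleteLinearOrder β]
  {f : α → β} {c : β}

theorem essSup_eq_of_forall_le (hle : ∀ x, f x ≤ c) (hc : μ {x | f x = c} ≠ 0) :
    essSup f μ = c := by
  have hset : {a | μ {x | a < f x} = 0} = Set.Ici c := by
    refine Set.ext fun a => ⟨fun ha => ?_, fun ha => ?_⟩
    · by_contra! hac
      refine hc (measure_mono_null (fun x hx => ?_) ha)
      exact (lt_of_not_ge hac).trans_eq (Eq.symm hx)
    · have hempty : {x | a < f x} = ∅ :=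
        Set.eq_empty_of_forall_notMem fun x hx => hx.not_ge ((hle x).trans ha)
      exact (congrArg μ hempty).trans measure_empty
  rw [essSup_eq_sInf, hset, csInf_Ici]

theorem essInf_eq_of_forall_ge (hge : ∀ x, c ≤ f x) (hc : μ {x | f x = c} ≠ 0) :
    essInf f μ = c :=
  essSup_eq_of_forall_le (β := βᵒᵈ) hge hc

end EssSup

section Jensen
variable {α : Type*} {m : MeasurableSpace α} {μ : Measure α}

theorem integrable_of_lintegral_ofReal_ne_top {u : α → ℝ} (hu : AEMeasurable u μ)
    (hpos : ∫⁻ x, ENNReal.ofReal (u x) ∂μ ≠ ∞) (hneg : ∫⁻ x, ENNReal.ofReal (-u x) ∂μ ≠ ∞) :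
    Integrable u μ := by
  refine ⟨hu.aestronglyMeasurable, ?_⟩
  calc ∫⁻ x, ‖u x‖ₑ ∂μ ≤ ∫⁻ x, (ENNReal.ofReal (u x) + ENNReal.ofReal (-u x)) ∂μ := by
        refine lintegral_mono fun x => ?_
        rcases le_total 0 (u x) with h | h
        · rw [Real.enorm_eq_ofReal h]; exact le_self_add
        · rw [← enorm_neg, Real.enorm_eq_ofReal (by linarith)]; exact le_add_self
    _ = ∫⁻ x, ENNReal.ofReal (u x) ∂μ + ∫⁻ x, ENNReal.ofReal (-u x) ∂μ :=
        lintegral_add_left' hu.ennreal_ofReal _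
    _ < ∞ := (ENNReal.add_ne_top.2 ⟨hpos, hneg⟩).lt_top

theorem ofReal_exp_average_le_laverage [IsFiniteMeasure μ] [NeZero μ] {u : α → ℝ}
    (hu : Integrable u μ) :
    ENNReal.ofReal (Real.exp (⨍ x, u x ∂μ)) ≤ ⨍⁻ x, ENNReal.ofReal (Real.exp (u x)) ∂μ := by
  by_cases hexp : Integrable (fun x => Real.exp (u x)) μ
  · rw [laverage_eq, ← ofReal_average hexp (.of_forall fun x => (Real.exp_pos _).le)]
    exact ENNReal.ofReal_le_ofReal <| convexOn_exp.map_average_le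
      Real.continuous_exp.continuousOn isClosed_univ (by simp) hu hexp
  · have htop : ∫⁻ x, ENNReal.ofReal (Real.exp (u x)) ∂μ = ∞ := by
      by_contra hfin
      refine hexp (integrable_of_lintegral_ofReal_ne_top
        (Real.measurable_exp.comp_aemeasurable hu.aemeasurable) hfin ?_)
      simp [ENNReal.ofReal_of_nonpos, Real.exp_nonneg]
    rw [laverage_eq, htop, ENNReal.top_div_of_ne_top (measure_ne_top μ _)]
    exact le_top

theorem lintegral_rpow_le_lintegral_rpow [IsProbabilityMeasure μ] {h : α → ℝ≥0∞}
    (hh : AEMeasurable h μ) {r : ℝ} (hr : 1 ≤ r) :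
    (∫⁻ x, h x ∂μ) ^ r ≤ ∫⁻ x, h x ^ r ∂μ := by
  have key := eLpNorm'_le_eLpNorm'_of_exponent_le one_pos hr μ hh.aestronglyMeasurable
  simp only [eLpNorm', enorm_eq_self, ENNReal.rpow_one, div_one] at key
  rwa [one_div, ENNReal.le_rpow_inv_iff (one_pos.trans_le hr)] at key

theorem lintegral_rpow_le_one_of_rpow_le_kernel {γ : Type*} [MeasurableSpace γ] {ν : Measure γ}
    [SFinite μ] [IsProbabilityMeasure ν] {F : α → ℝ≥0∞} {K : α → γ → ℝ≥0∞} {q : α → ℝ} {p : ℝ}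
    (hp : 0 < p) (hpq : ∀ x, p ≤ q x) (hq : Measurable q) (hK : Measurable (Function.uncurry K))
    (hFK : ∀ᵐ x ∂μ, F x ^ p ≤ ∫⁻ y, K x y ^ p ∂ν) (hK_le : ∀ y, ∫⁻ x, K x y ^ q x ∂μ ≤ 1) :
    ∫⁻ x, F x ^ q x ∂μ ≤ 1 := by
  have hpointwise : ∀ᵐ x ∂μ, F x ^ q x ≤ ∫⁻ y, K x y ^ q x ∂ν := by
    filter_upwards [hFK] with x hx
    have hr : 1 ≤ q x / p := (one_le_div hp).2 (hpq x)
    have hq_eq : q x = p * (q x / p) := by field_simp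
    calc F x ^ q x = (F x ^ p) ^ (q x / p) := by rw [← ENNReal.rpow_mul, ← hq_eq]
      _ ≤ (∫⁻ y, K x y ^ p ∂ν) ^ (q x / p) := by gcongr
      _ ≤ ∫⁻ y, (K x y ^ p) ^ (q x / p) ∂ν :=
          lintegral_rpow_le_lintegral_rpow (hK.of_uncurry_left.pow_const p).aemeasurable hr
      _ = ∫⁻ y, K x y ^ q x ∂ν := by simp_rw [← ENNReal.rpow_mul, ← hq_eq]
  have hmeas : Measurable (Function.uncurry fun x y => K x y ^ q x) :=
    hK.pow (hq.comp measurable_fst)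
  calc ∫⁻ x, F x ^ q x ∂μ ≤ ∫⁻ x, ∫⁻ y, K x y ^ q x ∂ν ∂μ := lintegral_mono_ae hpointwise
    _ = ∫⁻ y, ∫⁻ x, K x y ^ q x ∂μ ∂ν := lintegral_lintegral_swap hmeas.aemeasurable
    _ ≤ ∫⁻ _, 1 ∂ν := lintegral_mono hK_le
    _ = 1 := by simp

end Jensen

section Radial
variable {E : Type*} [NormedAddCommGroup E] [NormedSpace ℝ E] [FiniteDimensional ℝ E]
  [Nontrivial E] [MeasurableSpace E] [BorelSpace E] (μ : Measure E) [μ.IsAddHaarMeasure]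
  {S : Set ℝ} {t R : ℝ}

theorem integrableOn_norm_mem_iff (hS : MeasurableSet S) (f : ℝ → ℝ) :
    IntegrableOn (fun x => f ‖x‖) {x : E | ‖x‖ ∈ S} μ ↔
      IntegrableOn (fun r => r ^ (finrank ℝ E - 1) * f r) (Set.Ioi 0 ∩ S) := by
  have hmeas : MeasurableSet {x : E | ‖x‖ ∈ S} := measurable_norm hS
  rw [← integrable_indicator_iff hmeas]
  change Integrable (fun x => S.indicator f ‖x‖) μ ↔ _
  have hmul : (fun r => r ^ (finrank ℝ E - 1) • S.indicator f r) =
      S.indicator fun r => r ^ (finrank ℝ E - 1) * f r :=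
    funext fun r => by simp only [Set.indicator_mul_right, smul_eq_mul]
  rw [integrable_fun_norm_addHaar, hmul, IntegrableOn, integrable_indicator_iff hS, IntegrableOn,
    IntegrableOn, Measure.restrict_restrict hS, Set.inter_comm]

theorem setIntegral_norm_mem (hS : MeasurableSet S) (f : ℝ → ℝ) :
    ∫ x in {x : E | ‖x‖ ∈ S}, f ‖x‖ ∂μ = finrank ℝ E * μ.real (ball 0 1) *
      ∫ r in Set.Ioi 0 ∩ S, r ^ (finrank ℝ E - 1) * f r := by
  have hmeas : MeasurableSet {x : E | ‖x‖ ∈ S} := measurable_norm hS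
  rw [← integral_indicator hmeas]
  change ∫ x, S.indicator f ‖x‖ ∂μ = _
  rw [integral_fun_norm_addHaar, ← setIntegral_indicator hS, nsmul_eq_mul, smul_eq_mul, mul_assoc]
  simp only [Set.indicator_mul_right, smul_eq_mul]

theorem addHaar_real_ball_diff_closedBall (ht : 0 ≤ t) (htR : t < R) :
    μ.real (ball (0 : E) R \ closedBall 0 t) =
      (R ^ finrank ℝ E - t ^ finrank ℝ E) * μ.real (ball 0 1) := by
  rw [measureReal_sdiff (closedBall_subset_ball htR) measurableSet_closedBall,
    ← μ.addHaar_real_closedBall_eq_addHaar_real_ball, μ.addHaar_real_closedBall _ ht,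
    μ.addHaar_real_closedBall _ (ht.trans htR.le), sub_mul]

theorem setLIntegral_lt_norm_rpow {τ : ℝ} (ht : 0 < t) (hτ : 0 < τ) :
    ∫⁻ x in {x : E | t < ‖x‖}, ENNReal.ofReal (t ^ τ * ‖x‖ ^ (-finrank ℝ E - τ)) ∂μ =
      ENNReal.ofReal (finrank ℝ E * μ.real (ball 0 1) / τ) := by
  have hdim : 1 ≤ finrank ℝ E := finrank_pos
  have hinter : Set.Ioi 0 ∩ Set.Ioi t = Set.Ioi t :=
    Set.inter_eq_right.2 (Set.Ioi_subset_Ioi ht.le)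
  have hradial : ∀ r ∈ Set.Ioi t, r ^ (finrank ℝ E - 1) * (t ^ τ * r ^ (-finrank ℝ E - τ)) =
      t ^ τ * r ^ (-1 - τ) := fun r hr => by
    rw [mul_left_comm, ← Real.rpow_natCast, ← Real.rpow_add (ht.trans hr), Nat.cast_sub hdim]
    congr 2; push_cast; ring
  have hint : IntegrableOn (fun r : ℝ => t ^ τ * r ^ (-1 - τ)) (Set.Ioi t) :=
    (integrableOn_Ioi_rpow_of_lt (by linarith) ht).const_mul _
  change ∫⁻ x in {x : E | ‖x‖ ∈ Set.Ioi t}, _ ∂μ = _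
  rw [← ofReal_integral_eq_lintegral_ofReal
    ((integrableOn_norm_mem_iff μ measurableSet_Ioi fun r => t ^ τ * r ^ (-finrank ℝ E - τ)).2
      (by rwa [hinter, integrableOn_congr_fun hradial measurableSet_Ioi]))
    (.of_forall fun x => by positivity),
    setIntegral_norm_mem μ measurableSet_Ioi fun r => t ^ τ * r ^ (-finrank ℝ E - τ), hinter,
    setIntegral_congr_fun measurableSet_Ioi hradial, integral_const_mul,
    integral_Ioi_rpow_of_lt (by linarith) ht, show -1 - τ + 1 = -τ by ring, Real.rpow_neg ht.le]
  have : t ^ τ ≠ 0 := by positivity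
  congr 1
  field_simp

theorem intervalIntegrable_pow_mul_log (k : ℕ) (a b : ℝ) :
    IntervalIntegrable (fun r : ℝ => r ^ k * Real.log r) volume a b :=
  intervalIntegral.intervalIntegrable_log'.continuousOn_mul (by fun_prop)

theorem hasDerivAt_pow_mul_log {r : ℝ} (k : ℕ) (hr : r ≠ 0) :
    HasDerivAt (fun r => r ^ (k + 1) * Real.log r) (r ^ k * (1 + (k + 1) * Real.log r)) r := by
  convert! (hasDerivAt_pow (k + 1) r).mul (Real.hasDerivAt_log hr) using 1
  push_cast
  field_simp
  ring

theorem integral_pow_mul_one_add_log (k : ℕ) (hR : 0 ≤ R) :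
    ∫ r in 0..R, r ^ k * (1 + (k + 1) * Real.log r) = R ^ (k + 1) * Real.log R := by
  have hcont : Continuous fun r : ℝ => r ^ (k + 1) * Real.log r := by
    simp only [pow_succ, mul_assoc]
    exact (continuous_pow k).mul Real.continuous_mul_log
  rw [intervalIntegral.integral_eq_sub_of_hasDerivAt_of_le hR hcont.continuousOn
    (fun r hr => hasDerivAt_pow_mul_log k hr.1.ne'), Real.log_zero, mul_zero, sub_zero]
  exact ((intervalIntegral.intervalIntegrable_pow k).add
    ((intervalIntegrable_pow_mul_log k 0 R).const_mul (k + 1))).congr fun r _ => by ring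

theorem integrableOn_log_norm_ball (hR : 0 ≤ R) :
    IntegrableOn (fun x : E => Real.log ‖x‖) (ball 0 R) μ := by
  have hball : ball (0 : E) R = {x | ‖x‖ ∈ Set.Iio R} := ball_zero_eq R
  rw [hball, integrableOn_norm_mem_iff μ measurableSet_Iio, Set.Ioi_inter_Iio,
    ← intervalIntegrable_iff_integrableOn_Ioo_of_le hR]
  exact intervalIntegrable_pow_mul_log _ 0 R

theorem integrableOn_one_add_log_norm_ball (hR : 0 ≤ R) (c : ℝ) :
    IntegrableOn (fun x : E => 1 + c * Real.log ‖x‖) (ball 0 R) μ :=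
  (integrableOn_const measure_ball_lt_top.ne).add ((integrableOn_log_norm_ball μ hR).const_mul c)

theorem setIntegral_ball_one_add_log (hR : 0 ≤ R) :
    ∫ x in ball (0 : E) R, (1 + finrank ℝ E * Real.log ‖x‖) ∂μ =
      μ.real (ball 0 R) * (finrank ℝ E * Real.log R) := by
  have hball : ball (0 : E) R = {x | ‖x‖ ∈ Set.Iio R} := ball_zero_eq R
  have hdim : finrank ℝ E - 1 + 1 = finrank ℝ E := Nat.sub_add_cancel finrank_pos
  have hintegral := integral_pow_mul_one_add_log (finrank ℝ E - 1) hR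
  rw [← Nat.cast_succ, Nat.succ_eq_add_one, hdim] at hintegral
  rw [← μ.addHaar_real_closedBall_eq_addHaar_real_ball 0 R, μ.addHaar_real_closedBall _ hR, hball,
    setIntegral_norm_mem μ measurableSet_Iio fun r => 1 + finrank ℝ E * Real.log r,
    Set.Ioi_inter_Iio, ← integral_Ioc_eq_integral_Ioo, ← intervalIntegral.integral_of_le hR,
    hintegral]
  ring

theorem setAverage_log_norm_ball (hR : 0 < R) :
    ⨍ x in ball (0 : E) R, Real.log ‖x‖ ∂μ = Real.log R - 1 / finrank ℝ E := by
  have hdim : (finrank ℝ E : ℝ) ≠ 0 := Nat.cast_ne_zero.2 finrank_pos.ne'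
  have hvol : μ.real (ball (0 : E) R) ≠ 0 :=
    (ENNReal.toReal_pos (measure_ball_pos μ 0 hR).ne' measure_ball_lt_top.ne).ne'
  have hintegral := setIntegral_ball_one_add_log μ hR.le
  rw [integral_add (integrableOn_const measure_ball_lt_top.ne).integrable
    ((integrableOn_log_norm_ball μ hR.le).const_mul _),
    setIntegral_const, integral_const_mul, smul_eq_mul, mul_one] at hintegral
  rw [setAverage_eq, smul_eq_mul]
  field_simp
  linarith

theorem one_add_log_norm_div_ae_eq (ht : t ≠ 0) (c : ℝ) (B : Set E) :
    (fun x => 1 + c * Real.log (‖x‖ / t)) =ᵐ[μ.restrict B]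
      fun x => (1 + c * Real.log ‖x‖) - c * Real.log t := by
  refine ae_restrict_of_ae ?_
  filter_upwards [Measure.ae_ne μ 0] with x hx
  rw [Real.log_div (norm_ne_zero_iff.2 hx) ht]
  ring

theorem integrableOn_one_add_log_norm_div_ball (ht : t ≠ 0) (hR : 0 ≤ R) (c : ℝ) :
    IntegrableOn (fun x : E => 1 + c * Real.log (‖x‖ / t)) (ball 0 R) μ :=
  (integrable_congr (one_add_log_norm_div_ae_eq μ ht c _)).2 <|
    (integrableOn_one_add_log_norm_ball μ hR c).sub (integrableOn_const measure_ball_lt_top.ne)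

theorem setIntegral_ball_one_add_log_div (ht : 0 < t) (hR : 0 < R) :
    ∫ x in ball (0 : E) R, (1 + finrank ℝ E * Real.log (‖x‖ / t)) ∂μ =
      μ.real (ball 0 R) * (finrank ℝ E * Real.log (R / t)) := by
  rw [integral_congr_ae (one_add_log_norm_div_ae_eq μ ht.ne' _ _),
    integral_sub (integrableOn_one_add_log_norm_ball μ hR.le _)
      (integrableOn_const measure_ball_lt_top.ne),
    setIntegral_ball_one_add_log μ hR.le, setIntegral_const, smul_eq_mul,
    Real.log_div hR.ne' ht.ne']
  ring

-- The function `1 + d log (‖x‖ / t)` has mean zero over the ball of radius `t`, so that cutting it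
-- off there does not change its integral.
theorem setIntegral_ball_indicator_one_add_log_div (ht : 0 < t) (htR : t < R) :
    ∫ x in ball (0 : E) R, {x | t < ‖x‖}.indicator
        (fun x => 1 + finrank ℝ E * Real.log (‖x‖ / t)) x ∂μ =
      μ.real (ball 0 R) * (finrank ℝ E * Real.log (R / t)) := by
  have hR : 0 < R := ht.trans htR
  have hdiff : ball 0 R ∩ {x : E | t < ‖x‖} = ball 0 R \ closedBall 0 t := by
    ext x; simp
  have hmeas : MeasurableSet {x : E | t < ‖x‖} := measurableSet_lt measurable_const measurable_norm
  have hclosed : ball (0 : E) t =ᵐ[μ] closedBall 0 t :=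
    ae_eq_of_subset_of_measure_ge ball_subset_closedBall
      (μ.addHaar_closedBall_eq_addHaar_ball 0 t).le measurableSet_ball.nullMeasurableSet
      measure_closedBall_lt_top.ne
  rw [setIntegral_indicator hmeas, hdiff, setIntegral_sdiff measurableSet_closedBall
    (integrableOn_one_add_log_norm_div_ball μ ht.ne' hR.le _) (closedBall_subset_ball htR),
    ← setIntegral_congr_set hclosed, setIntegral_ball_one_add_log_div μ ht ht,
    setIntegral_ball_one_add_log_div μ ht hR, div_self ht.ne', Real.log_one, mul_zero, mul_zero,
    sub_zero]

end Radial
section Luxemburg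
variable {n : ℕ} {Ω Ω' : Set (EuclideanSpace ℝ (Fin n))} {q ω ω' : EuclideanSpace ℝ (Fin n) → ℝ}
  {f g : EuclideanSpace ℝ (Fin n) → ℝ≥0∞} {c l : ℝ≥0∞}

theorem luxemburgNorm_le_of_lintegral_le_one (hl : l ≠ 0)
    (hf : ∫⁻ x in Ω, (f x * ENNReal.ofReal (ω x) / l) ^ q x ≤ 1) : luxemburgNorm Ω q ω f ≤ l := by
  rcases eq_or_ne l ∞ with rfl | hl_top
  · exact le_top
  · exact sInf_le ⟨pos_iff_ne_zero.2 hl, hl_top.lt_top, hf⟩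

theorem lintegral_le_one_of_luxemburgNorm_lt (hq : ∀ x, 0 ≤ q x) (h : luxemburgNorm Ω q ω f < l) :
    ∫⁻ x in Ω, (f x * ENNReal.ofReal (ω x) / l) ^ q x ≤ 1 := by
  obtain ⟨l', ⟨-, -, hl'⟩, hlt⟩ := sInf_lt_iff.1 h
  refine le_trans (lintegral_mono fun x => ?_) hl'
  exact ENNReal.rpow_le_rpow (ENNReal.div_le_div_left hlt.le _) (hq x)

theorem luxemburgNorm_le_luxemburgNorm (hΩ : MeasurableSet Ω) (hsub : Ω ⊆ Ω')
    (hfg : ∀ x ∈ Ω, f x * ENNReal.ofReal (ω x) = g x * ENNReal.ofReal (ω' x)) :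
    luxemburgNorm Ω q ω f ≤ luxemburgNorm Ω' q ω' g := by
  refine sInf_le_sInf fun l ⟨hl, hl_top, hg⟩ => ⟨hl, hl_top, ?_⟩
  rw [setLIntegral_congr_fun hΩ fun x hx => by rw [hfg x hx]]
  exact (lintegral_mono_set hsub).trans hg

theorem luxemburgNorm_const_mul_le (hc : c ≠ 0) (hc_top : c ≠ ∞) :
    luxemburgNorm Ω q ω (fun x => c * f x) ≤ c * luxemburgNorm Ω q ω f := by
  rw [mul_comm, ← ENNReal.div_le_iff_le_mul (.inl hc) (.inl hc_top)]
  refine le_sInf fun l ⟨hl, _, hf⟩ => ?_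
  rw [ENNReal.div_le_iff_le_mul (.inl hc) (.inl hc_top), mul_comm]
  refine luxemburgNorm_le_of_lintegral_le_one (mul_ne_zero hc hl.ne') ?_
  simpa only [mul_assoc, ENNReal.mul_div_mul_left _ _ hc hc_top] using hf

theorem luxemburgNorm_const_mul (hc : c ≠ 0) (hc_top : c ≠ ∞) :
    luxemburgNorm Ω q ω (fun x => c * f x) = c * luxemburgNorm Ω q ω f := by
  refine (luxemburgNorm_const_mul_le hc hc_top).antisymm ?_
  rw [ENNReal.mul_le_iff_le_inv hc hc_top]
  calc luxemburgNorm Ω q ω f = luxemburgNorm Ω q ω (fun x => c⁻¹ * (c * f x)) := by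
        simp only [ENNReal.inv_mul_cancel_left hc hc_top]
    _ ≤ c⁻¹ * luxemburgNorm Ω q ω (fun x => c * f x) :=
        luxemburgNorm_const_mul_le (ENNReal.inv_ne_zero.2 hc_top) (ENNReal.inv_ne_top.2 hc)

theorem luxemburgNorm_le_max_one_lintegral (hq : ∀ x, 1 ≤ q x) :
    luxemburgNorm Ω q ω f ≤ max 1 (∫⁻ x in Ω, (f x * ENNReal.ofReal (ω x)) ^ q x) := by
  set I := ∫⁻ x in Ω, (f x * ENNReal.ofReal (ω x)) ^ q x
  have hone : 1 ≤ max 1 I := le_max_left _ _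
  have hL : max 1 I ≠ 0 := (one_pos.trans_le hone).ne'
  refine luxemburgNorm_le_of_lintegral_le_one hL ?_
  calc ∫⁻ x in Ω, (f x * ENNReal.ofReal (ω x) / max 1 I) ^ q x
      ≤ ∫⁻ x in Ω, (f x * ENNReal.ofReal (ω x)) ^ q x * (max 1 I)⁻¹ := by
        refine lintegral_mono fun x => ?_
        rw [ENNReal.div_rpow_of_nonneg _ _ (zero_le_one.trans (hq x)), div_eq_mul_inv]
        gcongr
        exact ENNReal.le_rpow_self_of_one_le hone (hq x)
    _ = I / max 1 I := lintegral_mul_const' _ _ (ENNReal.inv_ne_top.2 hL)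
    _ ≤ 1 := ENNReal.div_le_of_le_mul (by rw [one_mul]; exact le_max_right _ _)

end Luxemburg

section TailNorm
variable {n : ℕ} {q : EuclideanSpace ℝ (Fin n) → ℝ} {β s p σ a t L D : ℝ}

/-- The volume `|B(0,1)|` of the Euclidean unit ball of `ℝⁿ`, as a real number. -/
noncomputable def unitBallVolume (n : ℕ) : ℝ :=
  volume.real (ball (0 : EuclideanSpace ℝ (Fin n)) 1)

theorem unitBallVolume_pos (n : ℕ) : 0 < unitBallVolume n :=
  ENNReal.toReal_pos (measure_ball_pos _ _ one_pos).ne' measure_ball_lt_top.ne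

theorem ofReal_unitBallVolume (n : ℕ) :
    ENNReal.ofReal (unitBallVolume n) = volume (ball (0 : EuclideanSpace ℝ (Fin n)) 1) :=
  ENNReal.ofReal_toReal measure_ball_lt_top.ne

/-- The quantity `t^σ ‖ |·|^a ‖_{L_{q(·)}(|x| > t)}`. For `σ = n(s-1)/p` and `a = β - ns/p`, its
supremum over `t > 0` is `|B(0,1)|^{1/p} D'(s,p,q)`. The factor `t^σ` is put inside the quasi-norm,
where the integrals defining it are invariant under scaling. -/
noncomputable def tailNorm (q : EuclideanSpace ℝ (Fin n) → ℝ) (σ a t : ℝ) : ℝ≥0∞ :=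
  luxemburgNorm {x | t < ‖x‖} q (fun _ => 1) fun x => ENNReal.ofReal (t ^ σ * ‖x‖ ^ a)

theorem measurableSet_lt_norm (t : ℝ) : MeasurableSet {x : EuclideanSpace ℝ (Fin n) | t < ‖x‖} :=
  measurableSet_lt measurable_const measurable_norm

theorem tailNorm_eq_mul (ht : 0 < t) :
    tailNorm q σ a t = ENNReal.ofReal (t ^ σ) *
      luxemburgNorm {x | t < ‖x‖} q (fun _ => 1) fun x => ENNReal.ofReal (‖x‖ ^ a) := by
  have hpos : 0 < t ^ σ := by positivity
  rw [← luxemburgNorm_const_mul (ENNReal.ofReal_pos.2 hpos).ne' ENNReal.ofReal_ne_top]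
  simp only [tailNorm, ENNReal.ofReal_mul hpos.le]

theorem lintegral_tail_le_one_of_tailNorm_lt (hq : ∀ x, 0 ≤ q x) (hL : 0 < L)
    (h : tailNorm q σ a t < ENNReal.ofReal L) :
    ∫⁻ x in {x | t < ‖x‖}, ENNReal.ofReal (t ^ σ * ‖x‖ ^ a / L) ^ q x ≤ 1 := by
  simpa only [ENNReal.ofReal_one, mul_one, ← ENNReal.ofReal_div_of_pos hL] using
    lintegral_le_one_of_luxemburgNorm_lt hq h

theorem dPrime_eq_mul_iSup_tailNorm (q : EuclideanSpace ℝ (Fin n) → ℝ) (β s p : ℝ) :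
    dPrime q β s p = ENNReal.ofReal (unitBallVolume n ^ (-1 / p)) *
      ⨆ (t : ℝ) (_ : 0 < t), tailNorm q (n * (s - 1) / p) (β - n * s / p) t := by
  rw [dPrime, ← ENNReal.ofReal_rpow_of_pos (unitBallVolume_pos n), ofReal_unitBallVolume]
  congr 1
  exact iSup_congr fun t => iSup_congr fun ht => (tailNorm_eq_mul ht).symm

theorem dPrime_le_of_tailNorm_le {A : ℝ≥0∞}
    (h : ∀ t, 0 < t → tailNorm q (n * (s - 1) / p) (β - n * s / p) t ≤ A) :
    dPrime q β s p ≤ ENNReal.ofReal (unitBallVolume n ^ (-1 / p)) * A := by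
  rw [dPrime_eq_mul_iSup_tailNorm]
  gcongr
  exact iSup₂_le h

theorem tailNorm_lt_of_dPrime_lt (h : dPrime q β s p < ENNReal.ofReal D) (ht : 0 < t) :
    tailNorm q (n * (s - 1) / p) (β - n * s / p) t <
      ENNReal.ofReal (unitBallVolume n ^ (1 / p) * D) := by
  have hV := unitBallVolume_pos n
  have hpos : 0 < unitBallVolume n ^ (-1 / p) := by positivity
  have hcancel : unitBallVolume n ^ (-1 / p) * (unitBallVolume n ^ (1 / p) * D) = D := by
    rw [← mul_assoc, ← Real.rpow_add hV, neg_div, neg_add_cancel, Real.rpow_zero, one_mul]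
  rw [dPrime_eq_mul_iSup_tailNorm, ← hcancel, ENNReal.ofReal_mul hpos.le] at h
  exact (le_iSup₂ (f := fun t (_ : 0 < t) => tailNorm q _ _ t) t ht).trans_lt
    (lt_of_mul_lt_mul_left' h)

end TailNorm

section GeometricMean
variable {n : ℕ} {p : ℝ} {f : EuclideanSpace ℝ (Fin n) → ℝ} {x : EuclideanSpace ℝ (Fin n)}
  {S : Set (EuclideanSpace ℝ (Fin n))}

theorem logIntegral_eq_coe_integral (hf : IntegrableOn (fun y => Real.log (f y)) S) :
    logIntegral f S = ((∫ y in S, Real.log (f y) : ℝ) : EReal) := by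
  have hpos : ∫⁻ y in S, ENNReal.ofReal (Real.log (f y)) ≠ ∞ := hf.lintegral_lt_top.ne
  have hneg : ∫⁻ y in S, ENNReal.ofReal (-Real.log (f y)) ≠ ∞ := hf.neg.lintegral_lt_top.ne
  rw [logIntegral, integral_eq_lintegral_pos_part_sub_lintegral_neg_part hf, EReal.coe_sub,
    EReal.coe_ennreal_toReal hpos, EReal.coe_ennreal_toReal hneg]

theorem geomMeanOp_eq_ofReal_exp_setAverage
    (hf : IntegrableOn (fun y => Real.log (f y)) (ball 0 ‖x‖)) :
    geomMeanOp f x = ENNReal.ofReal (Real.exp (⨍ y in ball 0 ‖x‖, Real.log (f y))) := by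
  rw [geomMeanOp, logIntegral_eq_coe_integral hf, setAverage_eq, smul_eq_mul, inv_mul_eq_div,
    measureReal_def, ← EReal.coe_ennreal_toReal measure_ball_lt_top.ne, ← EReal.coe_div,
    EReal.exp_coe]

theorem geomMeanOp_eq_zero (hx : x ≠ 0)
    (hf : ∫⁻ y in ball 0 ‖x‖, ENNReal.ofReal (-Real.log (f y)) = ∞) : geomMeanOp f x = 0 := by
  have hvol : 0 < volume (ball (0 : EuclideanSpace ℝ (Fin n)) ‖x‖) :=
    measure_ball_pos _ _ (norm_pos_iff.2 hx)
  rw [geomMeanOp, logIntegral, hf, EReal.coe_ennreal_top, EReal.sub_top,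
    EReal.bot_div_of_pos_ne_top (EReal.coe_ennreal_pos.2 hvol)
      (mt EReal.coe_ennreal_eq_top_iff.1 measure_ball_lt_top.ne), EReal.exp_bot]

theorem lintegral_ofReal_log_ne_top (hp : 0 < p) (hf : ∀ x, 0 < f x)
    (hfp : ∫⁻ x, ENNReal.ofReal (f x) ^ p ≠ ∞) (S : Set (EuclideanSpace ℝ (Fin n))) :
    ∫⁻ y in S, ENNReal.ofReal (Real.log (f y)) ≠ ∞ := by
  refine ne_top_of_le_ne_top (ENNReal.mul_ne_top (ENNReal.ofReal_ne_top (r := 1 / p)) hfp) ?_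
  rw [← lintegral_const_mul' _ _ ENNReal.ofReal_ne_top]
  refine (setLIntegral_le_lintegral S _).trans (lintegral_mono fun y => ?_)
  rw [ENNReal.ofReal_rpow_of_pos (hf y), ← ENNReal.ofReal_mul (by positivity), one_div_mul_eq_div]
  exact ENNReal.ofReal_le_ofReal (Real.log_le_rpow_div (hf y).le hp)

end GeometricMean

/-- The extremal function `t^{-n/p} 1_{|y| ≤ t} + e^{-s/p} t^{n(s-1)/p} |y|^{-ns/p} 1_{|y| > t}` on
which the inequality is tested to bound its constant from below. -/
noncomputable def testFun (n : ℕ) (p s t : ℝ) (y : EuclideanSpace ℝ (Fin n)) : ℝ :=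
  if ‖y‖ ≤ t then t ^ (-n / p)
  else Real.exp (-s / p) * t ^ (n * (s - 1) / p) * ‖y‖ ^ (-(n * s / p))

section LowerBound
variable {n : ℕ} {q : EuclideanSpace ℝ (Fin n) → ℝ} {p s t β : ℝ} {C : ℝ≥0}

theorem testFun_of_le {y : EuclideanSpace ℝ (Fin n)} (hy : ‖y‖ ≤ t) :
    testFun n p s t y = t ^ (-n / p) :=
  if_pos hy

theorem testFun_of_lt {y : EuclideanSpace ℝ (Fin n)} (hy : t < ‖y‖) :
    testFun n p s t y = Real.exp (-s / p) * t ^ (n * (s - 1) / p) * ‖y‖ ^ (-(n * s / p)) :=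
  if_neg hy.not_ge

theorem testFun_pos (ht : 0 < t) (y : EuclideanSpace ℝ (Fin n)) : 0 < testFun n p s t y := by
  rcases le_or_gt ‖y‖ t with hy | hy
  · rw [testFun_of_le hy]
    positivity
  · have hy_pos : 0 < ‖y‖ := ht.trans hy
    rw [testFun_of_lt hy]
    positivity

theorem measurable_testFun : Measurable (testFun n p s t) :=
  Measurable.ite (measurableSet_le measurable_norm measurable_const) (by fun_prop) (by fun_prop)

theorem log_testFun (ht : 0 < t) (y : EuclideanSpace ℝ (Fin n)) :
    Real.log (testFun n p s t y) = -n / p * Real.log t -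
      s / p * {y | t < ‖y‖}.indicator (fun y => 1 + n * Real.log (‖y‖ / t)) y := by
  rcases le_or_gt ‖y‖ t with hy | hy
  · rw [testFun_of_le hy, Real.log_rpow ht, Set.indicator_of_notMem (by simpa using hy)]
    ring
  · have hy_pos : 0 < ‖y‖ := ht.trans hy
    rw [testFun_of_lt hy, Set.indicator_of_mem (by simpa using hy),
      Real.log_mul (by positivity) (by positivity), Real.log_mul (by positivity) (by positivity),
      Real.log_exp, Real.log_rpow ht, Real.log_rpow hy_pos, Real.log_div hy_pos.ne' ht.ne']
    ring

theorem geomMeanOp_testFun [NeZero n] (ht : 0 < t) {x : EuclideanSpace ℝ (Fin n)} (hx : t < ‖x‖) :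
    geomMeanOp (testFun n p s t) x =
      ENNReal.ofReal (t ^ (n * (s - 1) / p) * ‖x‖ ^ (-(n * s / p))) := by
  have hR : 0 < ‖x‖ := ht.trans hx
  have hvol : volume.real (ball (0 : EuclideanSpace ℝ (Fin n)) ‖x‖) ≠ 0 :=
    (ENNReal.toReal_pos (measure_ball_pos _ 0 hR).ne' measure_ball_lt_top.ne).ne'
  have hconst : IntegrableOn (fun _ => -n / p * Real.log t)
      (ball (0 : EuclideanSpace ℝ (Fin n)) ‖x‖) := integrableOn_const measure_ball_lt_top.ne
  have hexcess : IntegrableOn ({y | t < ‖y‖}.indicator fun y => 1 + n * Real.log (‖y‖ / t))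
      (ball (0 : EuclideanSpace ℝ (Fin n)) ‖x‖) :=
    (integrableOn_one_add_log_norm_div_ball volume ht.ne' hR.le n).indicator
      (measurableSet_lt_norm t)
  have hmean : ⨍ y in ball 0 ‖x‖, Real.log (testFun n p s t y) =
      -n / p * Real.log t - s / p * (n * Real.log (‖x‖ / t)) := by
    have hintegral := setIntegral_ball_indicator_one_add_log_div
      (volume : Measure (EuclideanSpace ℝ (Fin n))) ht hx
    rw [finrank_euclideanSpace_fin] at hintegral
    simp only [log_testFun ht]
    rw [setAverage_eq, integral_sub hconst (hexcess.const_mul _), setIntegral_const,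
      integral_const_mul, hintegral, smul_eq_mul, smul_eq_mul]
    field_simp
  rw [geomMeanOp_eq_ofReal_exp_setAverage, hmean, Real.rpow_def_of_pos ht,
    Real.rpow_def_of_pos hR, ← Real.exp_add, Real.log_div hR.ne' ht.ne']
  · ring_nf
  · simp only [log_testFun ht]
    exact hconst.sub (hexcess.const_mul _)

theorem lintegral_testFun_rpow_closedBall [NeZero n] (hp : 0 < p) (ht : 0 < t) :
    ∫⁻ y in {y : EuclideanSpace ℝ (Fin n) | t < ‖y‖}ᶜ, ENNReal.ofReal (testFun n p s t y) ^ p =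
      ENNReal.ofReal (unitBallVolume n) := by
  have hball : {y : EuclideanSpace ℝ (Fin n) | t < ‖y‖}ᶜ = closedBall 0 t := by
    ext y; simp
  have hconst : ∀ y ∈ closedBall (0 : EuclideanSpace ℝ (Fin n)) t,
      ENNReal.ofReal (testFun n p s t y) ^ p = ENNReal.ofReal (t ^ n)⁻¹ := fun y hy => by
    rw [testFun_of_le (mem_closedBall_zero_iff.1 hy),
      ENNReal.ofReal_rpow_of_nonneg (by positivity) hp.le, ← Real.rpow_mul ht.le,
      div_mul_cancel₀ _ hp.ne', Real.rpow_neg ht.le, Real.rpow_natCast]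
  rw [hball, setLIntegral_congr_fun measurableSet_closedBall hconst, setLIntegral_const,
    Measure.addHaar_closedBall _ _ ht.le, finrank_euclideanSpace_fin, ← mul_assoc,
    ← ENNReal.ofReal_mul (by positivity), inv_mul_cancel₀ (by positivity), ENNReal.ofReal_one,
    one_mul, ofReal_unitBallVolume]

theorem lintegral_testFun_rpow_lt_norm [NeZero n] (hp : 0 < p) (hs : 1 < s) (ht : 0 < t) :
    ∫⁻ y in {y : EuclideanSpace ℝ (Fin n) | t < ‖y‖}, ENNReal.ofReal (testFun n p s t y) ^ p =
      ENNReal.ofReal (unitBallVolume n * (Real.exp (-s) / (s - 1))) := by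
  have hn : (0 : ℝ) < n := Nat.cast_pos.2 (NeZero.pos n)
  have hs' : 0 < s - 1 := sub_pos.2 hs
  have htail := setLIntegral_lt_norm_rpow (volume : Measure (EuclideanSpace ℝ (Fin n))) ht
    (mul_pos hn hs')
  rw [finrank_euclideanSpace_fin, ← unitBallVolume] at htail
  have hpow : ∀ y ∈ {y : EuclideanSpace ℝ (Fin n) | t < ‖y‖},
      ENNReal.ofReal (testFun n p s t y) ^ p = ENNReal.ofReal (Real.exp (-s)) *
        ENNReal.ofReal (t ^ (n * (s - 1)) * ‖y‖ ^ (-n - n * (s - 1))) := fun y hy => by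
    rw [testFun_of_lt hy, ENNReal.ofReal_rpow_of_nonneg (by positivity) hp.le,
      ← ENNReal.ofReal_mul (by positivity), Real.mul_rpow (by positivity) (by positivity),
      Real.mul_rpow (by positivity) (by positivity), ← Real.rpow_mul ht.le,
      ← Real.rpow_mul (norm_nonneg y), ← Real.exp_mul, div_mul_cancel₀ _ hp.ne',
      div_mul_cancel₀ _ hp.ne', neg_mul, div_mul_cancel₀ _ hp.ne', mul_assoc]
    congr 4
    ring
  rw [setLIntegral_congr_fun (measurableSet_lt_norm t) hpow,
    lintegral_const_mul' _ _ ENNReal.ofReal_ne_top, htail, ← ENNReal.ofReal_mul (by positivity)]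
  congr 1
  field_simp

theorem lintegral_testFun_rpow [NeZero n] (hp : 0 < p) (hs : 1 < s) (ht : 0 < t) :
    ∫⁻ y, ENNReal.ofReal (testFun n p s t y) ^ p =
      ENNReal.ofReal (unitBallVolume n * (1 + Real.exp (-s) / (s - 1))) := by
  have : 0 < s - 1 := sub_pos.2 hs
  have hV := unitBallVolume_pos n
  rw [← lintegral_add_compl _ (measurableSet_lt_norm t), lintegral_testFun_rpow_closedBall hp ht,
    lintegral_testFun_rpow_lt_norm hp hs ht, ← ENNReal.ofReal_add (by positivity) hV.le]
  ring_nf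

theorem GeomMeanInequality.tailNorm_le [NeZero n] (h : GeomMeanInequality q p β C)
    (hp : 0 < p) (hs : 1 < s) (ht : 0 < t) :
    tailNorm q (n * (s - 1) / p) (β - n * s / p) t ≤
      C * ENNReal.ofReal (unitBallVolume n * (1 + Real.exp (-s) / (s - 1))) ^ (1 / p) := by
  rw [← lintegral_testFun_rpow hp hs ht]
  refine le_trans ?_ (h _ measurable_testFun.aemeasurable (testFun_pos ht))
  refine luxemburgNorm_le_luxemburgNorm (measurableSet_lt_norm t) (Set.subset_univ _) fun x hx => ?_
  rw [geomMeanOp_testFun ht hx, ENNReal.ofReal_one, mul_one, ← ENNReal.ofReal_mul (by positivity),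
    mul_assoc, ← Real.rpow_add (ht.trans hx), neg_add_eq_sub]

theorem GeomMeanInequality.ofReal_mul_dPrime_le [NeZero n] (h : GeomMeanInequality q p β C)
    (hp : 0 < p) (hs : 1 < s) :
    ENNReal.ofReal (Real.exp (s / p) / (Real.exp s + 1 / (s - 1)) ^ (1 / p)) *
      dPrime q β s p ≤ C := by
  have hV := unitBallVolume_pos n
  have hs' : 0 < s - 1 := sub_pos.2 hs
  set K := 1 + Real.exp (-s) / (s - 1) with hK
  have hK_pos : 0 < K := by positivity
  have hsum : Real.exp s + 1 / (s - 1) = Real.exp s * K := by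
    rw [hK, Real.exp_neg]
    field_simp
  have hcancel : Real.exp (s / p) / (Real.exp s + 1 / (s - 1)) ^ (1 / p) *
      (unitBallVolume n ^ (-1 / p) * (unitBallVolume n * K) ^ (1 / p)) = 1 := by
    rw [hsum, Real.mul_rpow (Real.exp_pos s).le hK_pos.le, Real.mul_rpow hV.le hK_pos.le,
      ← Real.exp_mul, mul_one_div, neg_div, Real.rpow_neg hV.le]
    field_simp
  have hdPrime := dPrime_le_of_tailNorm_le fun t ht => h.tailNorm_le hp hs ht
  rw [ENNReal.ofReal_rpow_of_pos (by positivity), mul_left_comm,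
    ← ENNReal.ofReal_mul (by positivity)] at hdPrime
  calc _ ≤ _ := mul_le_mul_right hdPrime _
    _ = C := by
      rw [mul_left_comm, ← ENNReal.ofReal_mul (by positivity), hcancel, ENNReal.ofReal_one, mul_one]

theorem GeomMeanInequality.dPrime_lt_top [NeZero n] (h : GeomMeanInequality q p β C)
    (hp : 0 < p) (hs : 1 < s) : dPrime q β s p < ∞ :=
  (dPrime_le_of_tailNorm_le fun _ => h.tailNorm_le hp hs).trans_lt (by finiteness)

end LowerBound

section UpperBound
variable {n : ℕ} {p s β σ a L D : ℝ} {q : EuclideanSpace ℝ (Fin n) → ℝ}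
  {f : EuclideanSpace ℝ (Fin n) → ℝ} {g : EuclideanSpace ℝ (Fin n) → ℝ≥0∞}
  {x : EuclideanSpace ℝ (Fin n)}

theorem ofReal_exp_setAverage_log_rpow_le_setLAverage [NeZero n] (hf : ∀ x, 0 < f x) (hx : x ≠ 0)
    (hlog : IntegrableOn (fun y => Real.log (f y)) (ball 0 ‖x‖)) (κ : ℝ) :
    ENNReal.ofReal (Real.exp (p * ⨍ y in ball 0 ‖x‖, Real.log (f y))) ≤
      ENNReal.ofReal (Real.exp (κ / n) * ‖x‖ ^ (-κ)) *
        ⨍⁻ y in ball 0 ‖x‖, ENNReal.ofReal (f y ^ p * ‖y‖ ^ κ) ∂volume := by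
  have hR : 0 < ‖x‖ := norm_pos_iff.2 hx
  have : NeZero (volume (ball (0 : EuclideanSpace ℝ (Fin n)) ‖x‖)) :=
    ⟨(measure_ball_pos _ _ hR).ne'⟩
  have : Fact (volume (ball (0 : EuclideanSpace ℝ (Fin n)) ‖x‖) < ∞) := ⟨measure_ball_lt_top⟩
  have hf_int := hlog.const_mul p
  have hnorm_int := (integrableOn_log_norm_ball
    (volume : Measure (EuclideanSpace ℝ (Fin n))) hR.le).const_mul κ
  have haverage : ⨍ y in ball 0 ‖x‖, (p * Real.log (f y) + κ * Real.log ‖y‖) =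
      p * (⨍ y in ball 0 ‖x‖, Real.log (f y)) + κ * (Real.log ‖x‖ - 1 / n) := by
    have hnorm := setAverage_log_norm_ball (volume : Measure (EuclideanSpace ℝ (Fin n))) hR
    rw [finrank_euclideanSpace_fin] at hnorm
    rw [← hnorm]
    simp only [setAverage_eq, smul_eq_mul]
    rw [integral_add hf_int hnorm_int, integral_const_mul, integral_const_mul]
    ring
  have hexp : ∀ᵐ y ∂volume.restrict (ball 0 ‖x‖),
      ENNReal.ofReal (Real.exp (p * Real.log (f y) + κ * Real.log ‖y‖)) =
        ENNReal.ofReal (f y ^ p * ‖y‖ ^ κ) := by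
    filter_upwards [Measure.ae_ne _ (0 : EuclideanSpace ℝ (Fin n))] with y hy
    rw [Real.exp_add, Real.rpow_def_of_pos (hf y), Real.rpow_def_of_pos (norm_pos_iff.2 hy),
      mul_comm p, mul_comm κ]
  calc ENNReal.ofReal (Real.exp (p * ⨍ y in ball 0 ‖x‖, Real.log (f y)))
      = ENNReal.ofReal (Real.exp (κ / n) * ‖x‖ ^ (-κ)) * ENNReal.ofReal
          (Real.exp (⨍ y in ball 0 ‖x‖, (p * Real.log (f y) + κ * Real.log ‖y‖))) := by
        rw [← ENNReal.ofReal_mul (by positivity), haverage, Real.rpow_def_of_pos hR,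
          ← Real.exp_add, ← Real.exp_add]
        ring_nf
    _ ≤ _ := by
        rw [← laverage_congr hexp]
        gcongr
        exact ofReal_exp_average_le_laverage (hf_int.add hnorm_int)

theorem geomMeanOp_rpow_le_setLAverage [NeZero n] (hp : 0 < p) (hf : AEMeasurable f)
    (hf_pos : ∀ x, 0 < f x) (hfp : ∫⁻ x, ENNReal.ofReal (f x) ^ p ≠ ∞) (hx : x ≠ 0) (κ : ℝ) :
    geomMeanOp f x ^ p ≤ ENNReal.ofReal (Real.exp (κ / n) * ‖x‖ ^ (-κ)) *
      ⨍⁻ y in ball 0 ‖x‖, ENNReal.ofReal (f y ^ p * ‖y‖ ^ κ) ∂volume := by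
  by_cases hneg : ∫⁻ y in ball 0 ‖x‖, ENNReal.ofReal (-Real.log (f y)) = ∞
  · rw [geomMeanOp_eq_zero hx hneg, ENNReal.zero_rpow_of_pos hp]
    exact zero_le
  · have hlog : IntegrableOn (fun y => Real.log (f y)) (ball 0 ‖x‖) :=
      integrable_of_lintegral_ofReal_ne_top (Real.measurable_log.comp_aemeasurable hf).restrict
        (lintegral_ofReal_log_ne_top hp hf_pos hfp _) hneg
    rw [geomMeanOp_eq_ofReal_exp_setAverage hlog, ENNReal.ofReal_rpow_of_pos (Real.exp_pos _),
      ← Real.exp_mul, mul_comm _ p]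
    exact ofReal_exp_setAverage_log_rpow_le_setLAverage hf_pos hx hlog κ

/-- The Hardy-type kernel `|y|^σ |x|^a / L` on `{|y| < |x|}`, whose `L_p`-norm in `y` against the
density `f^p` dominates the geometric mean of `f`. -/
noncomputable def hardyKernel (σ a L : ℝ) (x y : EuclideanSpace ℝ (Fin n)) : ℝ≥0∞ :=
  if ‖y‖ < ‖x‖ then ENNReal.ofReal (‖y‖ ^ σ * ‖x‖ ^ a / L) else 0

theorem measurable_uncurry_hardyKernel :
    Measurable (Function.uncurry (hardyKernel (n := n) σ a L)) :=
  Measurable.ite (measurableSet_lt (by fun_prop) (by fun_prop)) (by fun_prop) measurable_const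

theorem lintegral_hardyKernel_rpow_le_one (hσ : σ ≠ 0) (hL : 0 < L) (hq : ∀ x, 0 < q x)
    (h : ∀ t, 0 < t → tailNorm q σ a t < ENNReal.ofReal L) (y : EuclideanSpace ℝ (Fin n)) :
    ∫⁻ x, hardyKernel σ a L x y ^ q x ≤ 1 := by
  have hindicator : ∀ x, hardyKernel σ a L x y ^ q x = {x | ‖y‖ < ‖x‖}.indicator
      (fun x => ENNReal.ofReal (‖y‖ ^ σ * ‖x‖ ^ a / L) ^ q x) x := fun x => by
    by_cases hxy : ‖y‖ < ‖x‖ <;> simp [hardyKernel, hxy, ENNReal.zero_rpow_of_pos (hq x)]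
  rw [lintegral_congr hindicator, lintegral_indicator (measurableSet_lt_norm _)]
  rcases (norm_nonneg y).eq_or_lt with hy | hy
  · simp [← hy, Real.zero_rpow hσ, ENNReal.zero_rpow_of_pos (hq _)]
  · exact lintegral_tail_le_one_of_tailNorm_lt (fun x => (hq x).le) hL (h _ hy)

theorem lintegral_mul_hardyKernel_rpow (hp : 0 < p) (hL : 0 < L) :
    ∫⁻ y, g y * hardyKernel σ a L x y ^ p = ENNReal.ofReal ((‖x‖ ^ a / L) ^ p) *
      ∫⁻ y in ball 0 ‖x‖, g y * ENNReal.ofReal (‖y‖ ^ (σ * p)) := by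
  rw [← lintegral_const_mul' _ _ ENNReal.ofReal_ne_top, ← lintegral_indicator measurableSet_ball]
  refine lintegral_congr fun y => ?_
  by_cases hy : ‖y‖ < ‖x‖
  · rw [hardyKernel, if_pos hy, Set.indicator_of_mem (mem_ball_zero_iff.2 hy), mul_left_comm,
      ← ENNReal.ofReal_mul (by positivity), ENNReal.ofReal_rpow_of_nonneg (by positivity) hp.le,
      mul_div_assoc, Real.mul_rpow (by positivity) (by positivity),
      ← Real.rpow_mul (norm_nonneg y), mul_comm (‖y‖ ^ _)]
  · rw [hardyKernel, if_neg hy, Set.indicator_of_notMem (mt mem_ball_zero_iff.1 hy),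
      ENNReal.zero_rpow_of_pos hp, mul_zero]

theorem geomMeanOp_mul_rpow_le_lintegral_hardyKernel [NeZero n] (hp : 0 < p) (hD : 0 < D)
    (hf : AEMeasurable f) (hf_pos : ∀ x, 0 < f x) (hfp : ∫⁻ x, ENNReal.ofReal (f x) ^ p ≠ ∞)
    (hx : x ≠ 0) :
    (geomMeanOp f x * ENNReal.ofReal (‖x‖ ^ β)) ^ p ≤
      ENNReal.ofReal (Real.exp ((s - 1) / p) * D) ^ p * ∫⁻ y, ENNReal.ofReal (f y) ^ p *
        hardyKernel (n * (s - 1) / p) (β - n * s / p) (unitBallVolume n ^ (1 / p) * D) x y ^ p := by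
  have hR : 0 < ‖x‖ := norm_pos_iff.2 hx
  have hV := unitBallVolume_pos n
  have hn : (n : ℝ) ≠ 0 := Nat.cast_ne_zero.2 (NeZero.ne n)
  have haverage : ⨍⁻ y in ball 0 ‖x‖, ENNReal.ofReal (f y ^ p * ‖y‖ ^ (n * (s - 1))) ∂volume =
      ENNReal.ofReal (‖x‖ ^ n * unitBallVolume n)⁻¹ * ∫⁻ y in ball 0 ‖x‖,
        ENNReal.ofReal (f y) ^ p * ENNReal.ofReal (‖y‖ ^ (n * (s - 1))) := by
    rw [setLAverage_eq, Measure.addHaar_ball _ _ hR.le, finrank_euclideanSpace_fin,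
      ← ofReal_unitBallVolume, ← ENNReal.ofReal_mul (by positivity), ENNReal.div_eq_inv_mul,
      ← ENNReal.ofReal_inv_of_pos (by positivity)]
    simp only [ENNReal.ofReal_rpow_of_pos (hf_pos _),
      ENNReal.ofReal_mul (Real.rpow_nonneg (hf_pos _).le p)]
  have hconst : Real.exp (n * (s - 1) / n) * ‖x‖ ^ (-(n * (s - 1))) *
      (‖x‖ ^ n * unitBallVolume n)⁻¹ * (‖x‖ ^ β) ^ p = (Real.exp ((s - 1) / p) * D) ^ p *
        (‖x‖ ^ (β - n * s / p) / (unitBallVolume n ^ (1 / p) * D)) ^ p := by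
    have hpow : ‖x‖ ^ ((β - n * s / p) * p) =
        ‖x‖ ^ (-(n * (s - 1))) * (‖x‖ ^ n)⁻¹ * ‖x‖ ^ (β * p) := by
      rw [← Real.rpow_natCast, ← Real.rpow_neg hR.le, ← Real.rpow_add hR, ← Real.rpow_add hR]
      congr 1
      field_simp
      ring
    rw [Real.div_rpow (by positivity) (by positivity), Real.mul_rpow (by positivity) hD.le,
      Real.mul_rpow (by positivity) hD.le, ← Real.exp_mul, ← Real.rpow_mul hR.le,
      ← Real.rpow_mul hR.le, ← Real.rpow_mul hV.le, hpow]
    field_simp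
    simp
  rw [lintegral_mul_hardyKernel_rpow hp (by positivity), div_mul_cancel₀ _ hp.ne',
    ENNReal.mul_rpow_of_nonneg _ _ hp.le, ENNReal.ofReal_rpow_of_pos (by positivity),
    ENNReal.ofReal_rpow_of_pos (by positivity), ← mul_assoc, ← ENNReal.ofReal_mul (by positivity),
    ← hconst]
  refine (mul_le_mul_left
    (geomMeanOp_rpow_le_setLAverage hp hf hf_pos hfp hx (n * (s - 1))) _).trans_eq ?_
  rw [haverage, ← mul_assoc, ← ENNReal.ofReal_mul (by positivity), mul_right_comm,
    ← ENNReal.ofReal_mul (by positivity)]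

theorem lintegral_ofReal_rpow_ne_zero (hf : AEMeasurable f) (hf_pos : ∀ x, 0 < f x) :
    ∫⁻ x, ENNReal.ofReal (f x) ^ p ≠ 0 := by
  rw [ne_eq, lintegral_eq_zero_iff' (hf.ennreal_ofReal.pow_const p)]
  intro h
  obtain ⟨x, hx⟩ := h.exists
  exact (ENNReal.rpow_pos (ENNReal.ofReal_pos.2 (hf_pos x)) ENNReal.ofReal_ne_top).ne' hx

theorem geomMeanOp_mul_div_rpow_le_lintegral_withDensity [NeZero n] (hp : 0 < p) (hD : 0 < D)
    (hf : AEMeasurable f) (hf_pos : ∀ x, 0 < f x) (hfp : ∫⁻ x, ENNReal.ofReal (f x) ^ p ≠ ∞)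
    (hx : x ≠ 0) :
    (geomMeanOp f x * ENNReal.ofReal (‖x‖ ^ β) / (ENNReal.ofReal (Real.exp ((s - 1) / p) * D) *
        (∫⁻ x, ENNReal.ofReal (f x) ^ p) ^ (1 / p))) ^ p ≤
      ∫⁻ y, hardyKernel (n * (s - 1) / p) (β - n * s / p) (unitBallVolume n ^ (1 / p) * D) x y ^ p
        ∂volume.withDensity fun y =>
          (∫⁻ x, ENNReal.ofReal (f x) ^ p)⁻¹ * ENNReal.ofReal (f y) ^ p := by
  have hfp_ne := lintegral_ofReal_rpow_ne_zero (p := p) hf hf_pos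
  rw [lintegral_withDensity_eq_lintegral_mul₀ ((hf.ennreal_ofReal.pow_const p).const_mul _)
    (measurable_uncurry_hardyKernel.of_uncurry_left.pow_const p).aemeasurable]
  simp only [Pi.mul_apply, mul_assoc]
  rw [lintegral_const_mul' _ _ (ENNReal.inv_ne_top.2 hfp_ne), ENNReal.div_rpow_of_nonneg _ _ hp.le,
    ENNReal.mul_rpow_of_nonneg _ (_ ^ (1 / p)) hp.le, ← ENNReal.rpow_mul,
    one_div_mul_cancel hp.ne', ENNReal.rpow_one]
  refine ENNReal.div_le_of_le_mul ?_
  refine (geomMeanOp_mul_rpow_le_lintegral_hardyKernel (s := s) hp hD hf hf_pos hfp hx).trans_eq ?_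
  rw [mul_comm _⁻¹, mul_mul_mul_comm, ENNReal.inv_mul_cancel hfp_ne hfp, mul_one, mul_comm]

theorem GeomMeanInequality.of_dPrime_lt [NeZero n] (hp : 0 < p) (hs : 1 < s) (hq : Measurable q)
    (hpq : ∀ x, p ≤ q x) (h : dPrime q β s p < ENNReal.ofReal D) :
    GeomMeanInequality q p β (Real.toNNReal (Real.exp ((s - 1) / p) * D)) := by
  intro f hf hf_pos
  change _ ≤ ENNReal.ofReal (Real.exp ((s - 1) / p) * D) * _
  have hD : 0 < D := ENNReal.ofReal_pos.1 (pos_of_gt h)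
  have hn : (0 : ℝ) < n := Nat.cast_pos.2 (NeZero.pos n)
  have hV := unitBallVolume_pos n
  have hC_ne : ENNReal.ofReal (Real.exp ((s - 1) / p) * D) ≠ 0 :=
    (ENNReal.ofReal_pos.2 (by positivity)).ne'
  have hfp_ne := lintegral_ofReal_rpow_ne_zero (p := p) hf hf_pos
  rcases eq_or_ne (∫⁻ x, ENNReal.ofReal (f x) ^ p) ∞ with hfp | hfp
  · rw [hfp, ENNReal.top_rpow_of_pos (by positivity), ENNReal.mul_top hC_ne]
    exact le_top
  have hprob : IsProbabilityMeasure (volume.withDensity fun y =>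
      (∫⁻ x, ENNReal.ofReal (f x) ^ p)⁻¹ * ENNReal.ofReal (f y) ^ p) := ⟨by
    rw [withDensity_apply _ .univ, Measure.restrict_univ,
      lintegral_const_mul' _ _ (ENNReal.inv_ne_top.2 hfp_ne), ENNReal.inv_mul_cancel hfp_ne hfp]⟩
  refine luxemburgNorm_le_of_lintegral_le_one (mul_ne_zero hC_ne (by simp [hfp_ne, hfp])) ?_
  rw [Measure.restrict_univ]
  refine lintegral_rpow_le_one_of_rpow_le_kernel hp hpq hq measurable_uncurry_hardyKernel
    ((Measure.ae_ne volume 0).mono fun x =>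
      geomMeanOp_mul_div_rpow_le_lintegral_withDensity (s := s) hp hD hf hf_pos hfp)
    (lintegral_hardyKernel_rpow_le_one (div_pos (mul_pos hn (sub_pos.2 hs)) hp).ne'
      (by positivity) (fun x => hp.trans_le (hpq x)) fun t ht => tailNorm_lt_of_dPrime_lt h ht)

theorem bestGeomMeanConstant_le [NeZero n] (hp : 0 < p) (hs : 1 < s) (hq : Measurable q)
    (hpq : ∀ x, p ≤ q x) :
    bestGeomMeanConstant q p β ≤ ENNReal.ofReal (Real.exp ((s - 1) / p)) * dPrime q β s p := by
  have hexp := Real.exp_pos ((s - 1) / p)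
  have hexp_ne : ENNReal.ofReal (Real.exp ((s - 1) / p)) ≠ 0 := (ENNReal.ofReal_pos.2 hexp).ne'
  rw [← ENNReal.div_le_iff' hexp_ne ENNReal.ofReal_ne_top]
  refine le_of_forall_gt_imp_ge_of_dense fun D hD => ?_
  rcases eq_or_ne D ∞ with rfl | hD_top
  · exact le_top
  rw [← ENNReal.ofReal_toReal hD_top] at hD ⊢
  rw [ENNReal.div_le_iff' hexp_ne ENNReal.ofReal_ne_top, ← ENNReal.ofReal_mul hexp.le]
  exact iInf₂_le _ (.of_dPrime_lt hp hs hq hpq hD)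

end UpperBound

section Annulus
variable {n : ℕ} {q : EuclideanSpace ℝ (Fin n) → ℝ} {σ a t r L : ℝ}

theorem min_one_two_rpow_mul_rpow_le (ht : 0 < t) (htr : t ≤ r) (hrt : r ≤ 2 * t) :
    min 1 (2 ^ a) * t ^ a ≤ r ^ a := by
  rcases le_total 0 a with ha | ha
  · calc min 1 (2 ^ a) * t ^ a ≤ 1 * t ^ a := by gcongr; exact min_le_left _ _
      _ ≤ r ^ a := by rw [one_mul]; exact Real.rpow_le_rpow ht.le htr ha
  · calc min 1 (2 ^ a) * t ^ a ≤ 2 ^ a * t ^ a := by gcongr; exact min_le_right _ _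
      _ = (2 * t) ^ a := (Real.mul_rpow two_pos.le ht.le).symm
      _ ≤ r ^ a := Real.rpow_le_rpow_of_nonpos (ht.trans_le htr) hrt ha

theorem setLIntegral_annulus_le_one (hL : 0 < L) (hr : 0 < r) (ht : 0 < t)
    (hq : ∀ x : EuclideanSpace ℝ (Fin n), t < ‖x‖ → ‖x‖ < 2 * t → q x = r)
    (h : ∫⁻ x in {x | t < ‖x‖}, ENNReal.ofReal (t ^ σ * ‖x‖ ^ a / L) ^ q x ≤ 1) :
    ∫⁻ _ in ball (0 : EuclideanSpace ℝ (Fin n)) (2 * t) \ closedBall 0 t,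
      ENNReal.ofReal ((t ^ σ * (min 1 (2 ^ a) * t ^ a) / L) ^ r) ≤ 1 := by
  have hannulus : ∀ x ∈ ball (0 : EuclideanSpace ℝ (Fin n)) (2 * t) \ closedBall 0 t,
      t < ‖x‖ ∧ ‖x‖ < 2 * t := fun x hx => by simpa [and_comm] using hx
  refine le_trans (setLIntegral_mono' (measurableSet_ball.diff measurableSet_closedBall)
    fun x hx => ?_) ((lintegral_mono_set fun x hx => (hannulus x hx).1).trans h)
  obtain ⟨htx, hxt⟩ := hannulus x hx
  rw [hq x htx hxt, ENNReal.ofReal_rpow_of_nonneg (by positivity) hr.le]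
  have := min_one_two_rpow_mul_rpow_le (a := a) ht htx.le hxt.le
  gcongr

theorem rpow_le_of_lintegral_tail_le_one [NeZero n] (hL : 0 < L) (hr : 0 < r) (ht : 0 < t)
    (hq : ∀ x : EuclideanSpace ℝ (Fin n), t < ‖x‖ → ‖x‖ < 2 * t → q x = r)
    (h : ∫⁻ x in {x | t < ‖x‖}, ENNReal.ofReal (t ^ σ * ‖x‖ ^ a / L) ^ q x ≤ 1) :
    t ^ (r * (σ + a) + n) ≤
      ((min 1 (2 ^ a) / L) ^ r * ((2 ^ n - 1) * unitBallVolume n))⁻¹ := by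
  have hV := unitBallVolume_pos n
  have htwo : (0 : ℝ) < 2 ^ n - 1 := sub_pos.2 (one_lt_pow₀ one_lt_two (NeZero.ne n))
  have hvolume : volume (ball (0 : EuclideanSpace ℝ (Fin n)) (2 * t) \ closedBall 0 t) =
      ENNReal.ofReal ((2 ^ n - 1) * t ^ n * unitBallVolume n) := by
    rw [← ofReal_measureReal (measure_ne_top_of_subset Set.sdiff_subset measure_ball_lt_top.ne),
      addHaar_real_ball_diff_closedBall _ ht.le (by linarith), finrank_euclideanSpace_fin,
      unitBallVolume]
    ring_nf
  have hbound := setLIntegral_annulus_le_one hL hr ht hq h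
  rw [setLIntegral_const, hvolume, ← ENNReal.ofReal_mul (by positivity),
    ENNReal.ofReal_le_one] at hbound
  have hfactor : t ^ σ * (min 1 (2 ^ a) * t ^ a) / L = min 1 (2 ^ a) / L * t ^ (σ + a) := by
    rw [Real.rpow_add ht]
    ring
  rw [hfactor, Real.mul_rpow (by positivity) (by positivity), ← Real.rpow_mul ht.le,
    mul_comm (σ + a)] at hbound
  rw [← one_div, le_div_iff₀ (by positivity), Real.rpow_add ht, Real.rpow_natCast]
  linarith

end Annulus

section StepExponent
variable {n : ℕ} {p s β σ a t : ℝ} {x : EuclideanSpace ℝ (Fin n)}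

theorem stepExponent_of_lt (hx : ‖x‖ < 1) : stepExponent n x = 1 :=
  if_pos hx

theorem stepExponent_of_le (hx : 1 ≤ ‖x‖) : stepExponent n x = 2 :=
  if_neg hx.not_gt

theorem one_le_stepExponent (x : EuclideanSpace ℝ (Fin n)) : 1 ≤ stepExponent n x := by
  unfold stepExponent
  split_ifs <;> norm_num

theorem stepExponent_le_two (x : EuclideanSpace ℝ (Fin n)) : stepExponent n x ≤ 2 := by
  unfold stepExponent
  split_ifs <;> norm_num

theorem measurable_stepExponent : Measurable (stepExponent n) :=
  Measurable.ite (measurableSet_lt measurable_norm measurable_const) measurable_const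
    measurable_const

theorem essInf_stepExponent (n : ℕ) : essInf (stepExponent n) volume = 1 := by
  refine essInf_eq_of_forall_ge one_le_stepExponent fun h => ?_
  refine (measure_ball_pos volume (0 : EuclideanSpace ℝ (Fin n)) one_pos).ne'
    (measure_mono_null (fun x hx => ?_) h)
  exact stepExponent_of_lt (mem_ball_zero_iff.1 hx)

theorem essSup_stepExponent (n : ℕ) [NeZero n] : essSup (stepExponent n) volume = 2 := by
  obtain ⟨x, hx⟩ := NormedSpace.exists_lt_norm ℝ (EuclideanSpace ℝ (Fin n)) 1
  refine essSup_eq_of_forall_le stepExponent_le_two fun h => ?_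
  refine ((isOpen_lt continuous_const continuous_norm).measure_pos volume ⟨x, hx⟩).ne'
    (measure_mono_null (fun y hy => ?_) h)
  exact stepExponent_of_le (le_of_lt hy)

theorem ofReal_rpow_stepExponent_le (ht : 0 < t) (hlow : -n ≤ σ + a) (hup : σ + a ≤ -n / 2)
    (hx : 0 < ‖x‖) :
    ENNReal.ofReal (t ^ σ * ‖x‖ ^ a) ^ stepExponent n x ≤
      ENNReal.ofReal (t ^ σ * ‖x‖ ^ (-n - σ)) +
        ENNReal.ofReal (t ^ (2 * σ) * ‖x‖ ^ (-n - 2 * σ)) := by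
  rcases lt_or_ge ‖x‖ 1 with hx_lt | hx_ge
  · rw [stepExponent_of_lt hx_lt, ENNReal.rpow_one]
    refine le_add_right (ENNReal.ofReal_le_ofReal ?_)
    exact mul_le_mul_of_nonneg_left
      (Real.rpow_le_rpow_of_exponent_ge hx hx_lt.le (by linarith)) (by positivity)
  · rw [stepExponent_of_le hx_ge, ENNReal.ofReal_rpow_of_nonneg (by positivity) zero_le_two,
      Real.mul_rpow (by positivity) (by positivity), ← Real.rpow_mul ht.le, ← Real.rpow_mul hx.le,
      mul_comm σ]
    refine le_add_left (ENNReal.ofReal_le_ofReal ?_)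
    exact mul_le_mul_of_nonneg_left
      (Real.rpow_le_rpow_of_exponent_le hx_ge (by linarith)) (by positivity)

theorem tailNorm_stepExponent_le [NeZero n] (ht : 0 < t) (hσ : 0 < σ) (hlow : -n ≤ σ + a)
    (hup : σ + a ≤ -n / 2) :
    tailNorm (stepExponent n) σ a t ≤ max 1 (ENNReal.ofReal (n * unitBallVolume n / σ) +
      ENNReal.ofReal (n * unitBallVolume n / (2 * σ))) := by
  have htail : ∀ τ : ℝ, 0 < τ → ∫⁻ x in {x : EuclideanSpace ℝ (Fin n) | t < ‖x‖},
      ENNReal.ofReal (t ^ τ * ‖x‖ ^ (-n - τ)) = ENNReal.ofReal (n * unitBallVolume n / τ) :=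
    fun τ hτ => by
      have := setLIntegral_lt_norm_rpow (volume : Measure (EuclideanSpace ℝ (Fin n))) ht hτ
      rwa [finrank_euclideanSpace_fin] at this
  refine (luxemburgNorm_le_max_one_lintegral one_le_stepExponent).trans (max_le_max_left 1 ?_)
  rw [← htail σ hσ, ← htail (2 * σ) (by positivity), ← lintegral_add_left (by fun_prop)]
  simp only [ENNReal.ofReal_one, mul_one]
  exact setLIntegral_mono' (measurableSet_lt_norm t) fun x hx =>
    ofReal_rpow_stepExponent_le ht hlow hup (ht.trans hx)

theorem dPrime_stepExponent_lt_top [NeZero n] (hp : 0 < p) (hs : 1 < s)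
    (hlow : n * (1 / p - 1) ≤ β) (hup : β ≤ n * (1 / p - 1 / 2)) :
    dPrime (stepExponent n) β s p < ∞ := by
  have hn : (0 : ℝ) < n := Nat.cast_pos.2 (NeZero.pos n)
  have hsum : n * (s - 1) / p + (β - n * s / p) = β - n * (1 / p) := by ring
  refine (dPrime_le_of_tailNorm_le fun t ht => tailNorm_stepExponent_le ht
    (div_pos (mul_pos hn (sub_pos.2 hs)) hp) ?_ ?_).trans_lt (by finiteness)
  all_goals linarith

theorem le_and_le_of_dPrime_stepExponent_lt_top [NeZero n] (h : dPrime (stepExponent n) β s p < ∞) :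
    n * (1 / p - 1) ≤ β ∧ β ≤ n * (1 / p - 1 / 2) := by
  obtain ⟨D, hD⟩ := ENNReal.lt_iff_exists_nnreal_btwn.1 h
  have hsum : n * (s - 1) / p + (β - n * s / p) = β - n * (1 / p) := by ring
  have hL : 0 < unitBallVolume n ^ (1 / p) * D :=
    mul_pos (Real.rpow_pos_of_pos (unitBallVolume_pos n) _) (by exact_mod_cast pos_of_gt hD.1)
  have htail := fun t (ht : 0 < t) => lintegral_tail_le_one_of_tailNorm_lt
    (fun x => zero_le_one.trans (one_le_stepExponent x)) hL
    (tailNorm_lt_of_dPrime_lt (by simpa only [ENNReal.ofReal_coe_nnreal] using hD.1) ht)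
  constructor
  · by_contra! hlt
    have hexp : 1 * (n * (s - 1) / p + (β - n * s / p)) + n < 0 := by linarith
    obtain ⟨t, ht_gt, ht_pos, ht_lt⟩ := (((tendsto_rpow_neg_nhdsGT_zero hexp).eventually_gt_atTop
      _).and (Ioo_mem_nhdsGT (show (0 : ℝ) < 1 / 2 by norm_num))).exists
    exact (rpow_le_of_lintegral_tail_le_one hL one_pos ht_pos
      (fun x _ hx => stepExponent_of_lt (by linarith)) (htail t ht_pos)).not_gt ht_gt
  · by_contra! hlt
    have hexp : 0 < 2 * (n * (s - 1) / p + (β - n * s / p)) + n := by linarith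
    obtain ⟨t, ht_ge, ht_gt⟩ := ((Filter.eventually_ge_atTop 1).and
      ((tendsto_rpow_atTop hexp).eventually_gt_atTop _)).exists
    have ht_pos : 0 < t := one_pos.trans_le ht_ge
    exact (rpow_le_of_lintegral_tail_le_one hL two_pos ht_pos
      (fun x hx _ => stepExponent_of_le (ht_ge.trans hx.le)) (htail t ht_pos)).not_gt ht_gt

theorem dPrime_stepExponent_lt_top_iff [NeZero n] (hp : 0 < p) (hs : 1 < s) :
    dPrime (stepExponent n) β s p < ∞ ↔ n * (1 / p - 1) ≤ β ∧ β ≤ n * (1 / p - 1 / 2) :=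
  ⟨le_and_le_of_dPrime_stepExponent_lt_top, fun h => dPrime_stepExponent_lt_top hp hs h.1 h.2⟩

end StepExponent

section Characterization
variable {n : ℕ} {p s β : ℝ} {q : EuclideanSpace ℝ (Fin n) → ℝ}

theorem exists_geomMeanInequality_iff_dPrime_lt_top [NeZero n] (hp : 0 < p) (hs : 1 < s)
    (hq : Measurable q) (hpq : ∀ x, p ≤ q x) :
    (∃ C : ℝ≥0, GeomMeanInequality q p β C) ↔ dPrime q β s p < ∞ := by
  refine ⟨fun ⟨C, hC⟩ => hC.dPrime_lt_top hp hs, fun h => ?_⟩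
  obtain ⟨D, hD, -⟩ := ENNReal.lt_iff_exists_nnreal_btwn.1 h
  rw [← ENNReal.ofReal_coe_nnreal] at hD
  exact ⟨_, .of_dPrime_lt hp hs hq hpq hD⟩

theorem ofReal_mul_dPrime_le_bestGeomMeanConstant [NeZero n] (hp : 0 < p) (hs : 1 < s) :
    ENNReal.ofReal (Real.exp (s / p) / (Real.exp s + 1 / (s - 1)) ^ (1 / p)) * dPrime q β s p ≤
      bestGeomMeanConstant q p β :=
  le_iInf₂ fun _ hC => hC.ofReal_mul_dPrime_le hp hs

end Characterization

theorem corollary2 (n : ℕ) (hn : 1 ≤ n) (p β : ℝ) (hp : 0 < p)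
    (hpq : ∀ x : EuclideanSpace ℝ (Fin n), p ≤ stepExponent n x) :
    ((∃ C : ℝ≥0, GeomMeanInequality (stepExponent n) p β C) ↔
      ∃ s ∈ Set.Icc 1 (1 + p / 2), n * (s / p - 1) ≤ β ∧ β ≤ n * (1 / p - 1 / 2)) ∧
    ((∃ C : ℝ≥0, GeomMeanInequality (stepExponent n) p β C) →
      (∀ s ∈ Set.Ioc 1 (1 + p / 2), dPrime (stepExponent n) β s p < ∞) ∧
      (⨆ s ∈ Set.Ioc 1 (1 + p / 2),
        ENNReal.ofReal (Real.exp (s / p) / (Real.exp s + 1 / (s - 1)) ^ (1 / p)) *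
          dPrime (stepExponent n) β s p) ≤ bestGeomMeanConstant (stepExponent n) p β ∧
      bestGeomMeanConstant (stepExponent n) p β ≤
        ENNReal.ofReal ((p / essInf (stepExponent n) volume +
            (essSup (stepExponent n) volume - p) / essSup (stepExponent n) volume) ^ (2 / p)) *
          ⨅ s ∈ Set.Ioc 1 (1 + p / 2),
            ENNReal.ofReal (Real.exp ((s - 1) / p)) * dPrime (stepExponent n) β s p) := by
  have : NeZero n := ⟨by omega⟩
  have hfinite : ∀ s, 1 < s → ((∃ C : ℝ≥0, GeomMeanInequality (stepExponent n) p β C) ↔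
      dPrime (stepExponent n) β s p < ∞) := fun s hs =>
    exists_geomMeanInequality_iff_dPrime_lt_top hp hs measurable_stepExponent hpq
  refine ⟨?_, fun hC => ⟨fun s hs => (hfinite s hs.1).1 hC, ?_, ?_⟩⟩
  · have hs : 1 < 1 + p / 2 := by linarith
    rw [hfinite _ hs, dPrime_stepExponent_lt_top_iff hp hs]
    refine ⟨fun h => ⟨1, ⟨le_rfl, hs.le⟩, h⟩, fun ⟨s, hs, hlow, hup⟩ => ⟨le_trans ?_ hlow, hup⟩⟩
    gcongr
    exact hs.1
  · exact iSup₂_le fun s hs => ofReal_mul_dPrime_le_bestGeomMeanConstant hp hs.1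
  · rw [essInf_stepExponent, essSup_stepExponent]
    have hconst : 1 ≤ ENNReal.ofReal ((p / 1 + (2 - p) / 2) ^ (2 / p)) :=
      ENNReal.one_le_ofReal.2 (Real.one_le_rpow (by linarith) (by positivity))
    refine le_trans (le_iInf₂ fun s hs => ?_) (le_mul_of_one_le_left' hconst)
    exact bestGeomMeanConstant_le hp hs.1 measurable_stepExponent hpq
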